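/- Let $\mathfrak A$ be the Weyl algebra over $\mathbb R^2$, that is, a nonzero unital $C^*$-algebra generated by unitary elements $W(x)$, $x\in\mathbb R^2$, satisfying the Weyl relations $W(x)W(y)=e^{i\sigma(x,y)}W(x+y)$, where $\sigma((a,b),(a',b'))=\tfrac12(ab'-ba')$. Let $\mathfrak A\otimes\mathfrak A$ be the spatial tensor product: for faithful unital $*$-representations $\pi_1,\pi_2$ of $\mathfrak A$ on Hilbert spaces $H_1,H_2$, it is the $C^*$-algebra of operators on the Hilbert space tensor product $H_1\otimes H_2$ generated by the operators $\pi_1(x)\otimes\pi_2(y)$ with $x,y\in\mathfrak A$, and $x\otimes y$ denotes $\pi_1(x)\otimes\pi_2(y)$. A state of a unital $C^*$-algebra is a linear functional $\omega$ that is positive ($\omega(x^*x)\ge 0$ for all $x$) and normalized ($\omega(1)=1$); it is pure if it is an extreme point of the convex set of all states. Then, for every such $\mathfrak A$, $W$, $\pi_1$, $\pi_2$ and for each pair of real numbers $\lambda,\mu$, there is a unique state $\omega$ of $\mathfrak A\otimes\mathfrak A$ such that $$\omega(W(a,0)\otimes W(-a,0))=e^{ia\lambda},\qquad \omega(W(0,b)\otimes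 W(0,b))=e^{ib\mu}$$ for all $a,b\in\mathbb R$. Moreover, $\omega$ is pure. -/

import Mathlib

open scoped TensorProduct ComplexOrder

noncomputable section

/-! States and pure states. -/

/-- A state of a unital complex `*`-algebra: a positive linear functional, normalized to `1` at
the unit. -/
structure IsState {A : Type*} [Ring A] [StarRing A] [Algebra ℂ A] (ω : A →ₗ[ℂ] ℂ) : Prop where
  nonneg : ∀ x : A, 0 ≤ ω (star x * x)
  map_one : ω 1 = 1

/-- A pure state is an extreme point of the convex set of all states. -/
def IsPureState {A : Type*} [Ring A] [StarRing A] [Algebra ℂ A] (ω : A →ₗ[ℂ] ℂ) : Prop :=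
  ω ∈ Set.extremePoints ℝ {ρ : A →ₗ[ℂ] ℂ | IsState ρ}

/-! The Weyl algebra over `ℝ²`. -/

/-- The symplectic form `σ((a,b),(a',b')) = (ab' - ba') / 2` on `ℝ²`. -/
def weylForm (x y : ℝ × ℝ) : ℝ := (1 / 2) * (x.1 * y.2 - x.2 * y.1)

/-- `W` exhibits the C⋆-algebra `A` as the Weyl algebra over `ℝ²`: `A` is a nonzero C⋆-algebra,
generated by the unitaries `W x`, which satisfy the Weyl relations
`W x * W y = exp (i σ(x, y)) W (x + y)`. -/
structure IsWeylAlgebra {A : Type*} [CStarAlgebra A] (W : ℝ × ℝ → A) : Prop where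
  nontrivial : Nontrivial A
  unitary : ∀ x, W x ∈ unitary A
  weyl : ∀ x y, W x * W y = Complex.exp (Complex.I * (weylForm x y : ℂ)) • W (x + y)
  generates : (StarAlgebra.adjoin ℂ (Set.range W)).topologicalClosure = ⊤

/-! The Weyl algebra over `ℝ²` exists: it is realized on `ℓ²(ℝ²)`. -/

section Existence

/-- The Hilbert space `ℓ²(ℝ²)`. -/
abbrev ellTwo : Type := lp (fun _ : ℝ × ℝ => ℂ) 2

theorem norm_weylPhase_mul (a x : ℝ × ℝ) (z : ℂ) :
    ‖Complex.exp (Complex.I * (weylForm a x : ℂ)) * z‖ = ‖z‖ := by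
  rw [norm_mul, mul_comm Complex.I, Complex.norm_exp_ofReal_mul_I, one_mul]

/-- The isometry `(W a f) x = exp (i σ(a, x)) f (x - a)` of `ℓ²(ℝ²)`. -/
def regularWeylIsometry (a : ℝ × ℝ) : ellTwo →ₗᵢ[ℂ] ellTwo where
  toFun f := ⟨fun x => Complex.exp (Complex.I * (weylForm a x : ℂ)) * f (x - a), by
    refine memℓp_gen ?_
    simp only [norm_weylPhase_mul]
    exact ((lp.memℓp f).summable (by norm_num)).comp_injective (sub_left_injective (b := a))⟩
  map_add' f g := by
    ext x
    exact mul_add _ _ _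
  map_smul' c f := by
    ext x
    simp [mul_left_comm]
  norm_map' f := by
    rw [lp.norm_eq_tsum_rpow (by norm_num), lp.norm_eq_tsum_rpow (by norm_num)]
    congr 1
    simp only [LinearMap.coe_mk, AddHom.coe_mk, norm_weylPhase_mul]
    exact (Equiv.subRight a).tsum_eq (fun x => ‖f x‖ ^ (2 : ENNReal).toReal)

/-- The Weyl operators on `ℓ²(ℝ²)`. -/
def regularWeyl (a : ℝ × ℝ) : ellTwo →L[ℂ] ellTwo :=
  (regularWeylIsometry a).toContinuousLinearMap

theorem regularWeyl_apply (a : ℝ × ℝ) (f : ellTwo) (x : ℝ × ℝ) :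
    regularWeyl a f x = Complex.exp (Complex.I * (weylForm a x : ℂ)) * f (x - a) := rfl

theorem regularWeyl_mul (a b : ℝ × ℝ) :
    regularWeyl a * regularWeyl b =
      Complex.exp (Complex.I * (weylForm a b : ℂ)) • regularWeyl (a + b) := by
  ext f x
  change regularWeyl a (regularWeyl b f) x =
    Complex.exp (Complex.I * (weylForm a b : ℂ)) * regularWeyl (a + b) f x
  rw [regularWeyl_apply, regularWeyl_apply, regularWeyl_apply, ← mul_assoc, ← mul_assoc,
    ← Complex.exp_add, ← Complex.exp_add, sub_sub]
  congr 2
  simp only [weylForm, Prod.fst_sub, Prod.snd_sub, Prod.fst_add, Prod.snd_add]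
  push_cast
  ring

theorem regularWeyl_zero : regularWeyl 0 = 1 := by
  ext f x
  change regularWeyl 0 f x = f x
  rw [regularWeyl_apply]
  simp [weylForm]

theorem regularWeyl_mul_neg (a : ℝ × ℝ) : regularWeyl a * regularWeyl (-a) = 1 := by
  rw [regularWeyl_mul, add_neg_cancel, regularWeyl_zero]
  have h : weylForm a (-a) = 0 := by simp [weylForm]; ring
  simp [h]

theorem regularWeyl_mem_unitary (a : ℝ × ℝ) :
    regularWeyl a ∈ unitary (ellTwo →L[ℂ] ellTwo) := by
  have h1 : star (regularWeyl a) * regularWeyl a = 1 :=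
    (ContinuousLinearMap.norm_map_iff_adjoint_comp_self (regularWeyl a)).mp
      (regularWeylIsometry a).norm_map
  refine Unitary.mem_iff.mpr ⟨h1, ?_⟩
  rw [left_inv_eq_right_inv h1 (regularWeyl_mul_neg a), regularWeyl_mul_neg]

/-- The Weyl algebra over `ℝ²`, realized on `ℓ²(ℝ²)`. -/
def regularWeylAlgebra : StarSubalgebra ℂ (ellTwo →L[ℂ] ellTwo) :=
  (StarAlgebra.adjoin ℂ (Set.range regularWeyl)).topologicalClosure

instance : CStarAlgebra regularWeylAlgebra :=
  StarSubalgebra.cstarAlgebra _ (h_closed := StarSubalgebra.isClosed_topologicalClosure _)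

/-- The Weyl unitaries as elements of the Weyl algebra. -/
def regularWeylElement (a : ℝ × ℝ) : regularWeylAlgebra :=
  ⟨regularWeyl a, StarSubalgebra.le_topologicalClosure _
    (StarAlgebra.subset_adjoin ℂ _ (Set.mem_range_self a))⟩

theorem isWeylAlgebra_regular : IsWeylAlgebra regularWeylElement where
  nontrivial := by
    refine ⟨⟨0, 1, fun h => ?_⟩⟩
    have h1 : (0 : ellTwo →L[ℂ] ellTwo) = 1 := congrArg Subtype.val h
    have h2 := congrArg (fun T : ellTwo →L[ℂ] ellTwo => T (lp.single 2 (0 : ℝ × ℝ) (1 : ℂ)) 0) h1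
    simp at h2
  unitary a := by
    have h := Unitary.mem_iff.mp (regularWeyl_mem_unitary a)
    exact Unitary.mem_iff.mpr ⟨Subtype.ext h.1, Subtype.ext h.2⟩
  weyl a b := Subtype.ext (regularWeyl_mul a b)
  generates := by
    set T : StarSubalgebra ℂ regularWeylAlgebra :=
      (StarAlgebra.adjoin ℂ (Set.range regularWeylElement)).topologicalClosure with hT
    have hclosed : IsClosed ((T.map regularWeylAlgebra.subtype :
        StarSubalgebra ℂ (ellTwo →L[ℂ] ellTwo)) : Set (ellTwo →L[ℂ] ellTwo)) := by
      have h1 : IsClosed (T : Set regularWeylAlgebra) :=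
        StarSubalgebra.isClosed_topologicalClosure _
      have h2 : IsClosed (regularWeylAlgebra : Set (ellTwo →L[ℂ] ellTwo)) :=
        StarSubalgebra.isClosed_topologicalClosure _
      exact h2.isClosedEmbedding_subtypeVal.isClosedMap _ h1
    have hle : regularWeylAlgebra ≤ T.map regularWeylAlgebra.subtype := by
      refine StarSubalgebra.topologicalClosure_minimal (StarAlgebra.adjoin_le ?_) hclosed
      rintro _ ⟨a, rfl⟩
      exact ⟨regularWeylElement a, StarSubalgebra.le_topologicalClosure _
        (StarAlgebra.subset_adjoin ℂ _ (Set.mem_range_self a)), rfl⟩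
    refine eq_top_iff.mpr fun x _ => ?_
    obtain ⟨y, hy, hyx⟩ := hle x.2
    have : y = x := Subtype.ext hyx
    exact this ▸ hy

end Existence

/-! The Hilbert space tensor product and tensor products of bounded operators. -/

section HilbertTensor

variable {H K : Type*} [NormedAddCommGroup H] [InnerProductSpace ℂ H]
  [NormedAddCommGroup K] [InnerProductSpace ℂ K]

variable (H K) in
/-- The Hilbert space tensor product: the completion of the algebraic tensor product for the
inner product `⟪x ⊗ y, x' ⊗ y'⟫ = ⟪x, x'⟫ ⟪y, y'⟫`. -/
def HilbertTensor : Type _ := UniformSpace.Completion (H ⊗[ℂ] K)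

instance : NormedAddCommGroup (HilbertTensor H K) :=
  inferInstanceAs (NormedAddCommGroup (UniformSpace.Completion (H ⊗[ℂ] K)))

instance : InnerProductSpace ℂ (HilbertTensor H K) :=
  inferInstanceAs (InnerProductSpace ℂ (UniformSpace.Completion (H ⊗[ℂ] K)))

instance : CompleteSpace (HilbertTensor H K) :=
  inferInstanceAs (CompleteSpace (UniformSpace.Completion (H ⊗[ℂ] K)))

/-- The elementary tensor `x ⊗ y` in the Hilbert space tensor product. -/
def hilbertTmul (x : H) (y : K) : HilbertTensor H K :=
  ((x ⊗ₜ[ℂ] y : H ⊗[ℂ] K) : UniformSpace.Completion (H ⊗[ℂ] K))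

theorem inner_hilbertTmul (x x' : H) (y y' : K) :
    inner ℂ (hilbertTmul x y) (hilbertTmul x' y') = inner ℂ x x' * inner ℂ y y' :=
  (UniformSpace.Completion.inner_coe (𝕜 := ℂ) (x ⊗ₜ[ℂ] y : H ⊗[ℂ] K) (x' ⊗ₜ[ℂ] y')).trans
    (TensorProduct.inner_tmul ℂ x x' y y')

/-- The elementary tensors span a dense subspace. -/
theorem dense_span_hilbertTmul :
    Dense (Submodule.span ℂ (Set.range fun p : H × K => hilbertTmul p.1 p.2) :
      Set (HilbertTensor H K)) := by
  have hd : DenseRange ((↑) : H ⊗[ℂ] K → UniformSpace.Completion (H ⊗[ℂ] K)) :=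
    UniformSpace.Completion.denseRange_coe
  refine Dense.mono ?_ hd
  rintro _ ⟨t, rfl⟩
  induction t with
  | zero => exact Submodule.zero_mem _
  | tmul x y => exact Submodule.subset_span ⟨(x, y), rfl⟩
  | add a b ha hb =>
    rw [UniformSpace.Completion.coe_add]
    exact Submodule.add_mem _ ha hb

variable [CompleteSpace H] [CompleteSpace K]

/-- `S ⊗ T` on the algebraic tensor product has formal adjoint `S† ⊗ T†`. -/
theorem inner_map_left (S : H →L[ℂ] H) (T : K →L[ℂ] K) (x y : H ⊗[ℂ] K) :
    inner ℂ (TensorProduct.map (S : H →ₗ[ℂ] H) (T : K →ₗ[ℂ] K) x) y =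
      inner ℂ x (TensorProduct.map ((star S : H →L[ℂ] H) : H →ₗ[ℂ] H)
        ((star T : K →L[ℂ] K) : K →ₗ[ℂ] K) y) := by
  induction x with
  | zero => simp
  | add a b ha hb => rw [map_add, inner_add_left, inner_add_left, ha, hb]
  | tmul a b =>
    induction y with
    | zero => simp
    | add c d hc hd => rw [map_add, inner_add_right, inner_add_right, hc, hd]
    | tmul c d =>
      simp [TensorProduct.map_tmul, TensorProduct.inner_tmul,
        ContinuousLinearMap.star_eq_adjoint, ContinuousLinearMap.adjoint_inner_right]

theorem star_mul_self_sq (S : H →L[ℂ] H) :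
    ∃ R : H →L[ℂ] H, star R * R + star S * S = algebraMap ℂ (H →L[ℂ] H) ((‖S‖ : ℂ) ^ 2) := by
  have h := CStarAlgebra.star_mul_le_algebraMap_norm_sq (a := S)
  obtain ⟨R, hR⟩ := CStarAlgebra.nonneg_iff_eq_star_mul_self.mp (sub_nonneg.mpr h)
  refine ⟨R, ?_⟩
  rw [← hR, sub_add_cancel, IsScalarTower.algebraMap_apply ℝ ℂ (H →L[ℂ] H)]
  simp

theorem norm_map_le_of_isometry_defect {S R : H →L[ℂ] H} {T Q : K →L[ℂ] K} {c : ℝ}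
    (hc : 0 ≤ c) (x : H ⊗[ℂ] K)
    (h : TensorProduct.map ((star R * R : H →L[ℂ] H) : H →ₗ[ℂ] H)
          ((star Q * Q : K →L[ℂ] K) : K →ₗ[ℂ] K) x +
        TensorProduct.map ((star S * S : H →L[ℂ] H) : H →ₗ[ℂ] H)
          ((star T * T : K →L[ℂ] K) : K →ₗ[ℂ] K) x = ((c : ℂ) ^ 2) • x) :
    ‖TensorProduct.map (S : H →ₗ[ℂ] H) (T : K →ₗ[ℂ] K) x‖ ≤ c * ‖x‖ := by
  have key : ∀ (S : H →L[ℂ] H) (T : K →L[ℂ] K),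
      inner ℂ x (TensorProduct.map ((star S * S : H →L[ℂ] H) : H →ₗ[ℂ] H)
        ((star T * T : K →L[ℂ] K) : K →ₗ[ℂ] K) x) =
      ((‖TensorProduct.map (S : H →ₗ[ℂ] H) (T : K →ₗ[ℂ] K) x‖ : ℂ)) ^ 2 := by
    intro S T
    have e : TensorProduct.map ((star S * S : H →L[ℂ] H) : H →ₗ[ℂ] H)
        ((star T * T : K →L[ℂ] K) : K →ₗ[ℂ] K) x =
        TensorProduct.map ((star S : H →L[ℂ] H) : H →ₗ[ℂ] H)
          ((star T : K →L[ℂ] K) : K →ₗ[ℂ] K)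
          (TensorProduct.map (S : H →ₗ[ℂ] H) (T : K →ₗ[ℂ] K) x) := by
      rw [← LinearMap.comp_apply, ← TensorProduct.map_comp]
      rfl
    rw [e, ← inner_map_left]
    exact inner_self_eq_norm_sq_to_K (𝕜 := ℂ) (E := H ⊗[ℂ] K) _
  have h2 := congrArg (inner ℂ x) h
  have h4 : inner ℂ x (((c : ℂ) ^ 2) • x) = (c : ℂ) ^ 2 * (‖x‖ : ℂ) ^ 2 :=
    (inner_smul_right (𝕜 := ℂ) (E := H ⊗[ℂ] K) x x ((c : ℂ) ^ 2)).trans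
      (congrArg (fun z => (c : ℂ) ^ 2 * z)
        (inner_self_eq_norm_sq_to_K (𝕜 := ℂ) (E := H ⊗[ℂ] K) x))
  rw [inner_add_right, key, key, h4] at h2
  have h3 : ‖TensorProduct.map (R : H →ₗ[ℂ] H) (Q : K →ₗ[ℂ] K) x‖ ^ 2 +
      ‖TensorProduct.map (S : H →ₗ[ℂ] H) (T : K →ₗ[ℂ] K) x‖ ^ 2 = c ^ 2 * ‖x‖ ^ 2 := by
    exact_mod_cast h2
  refine abs_le_of_sq_le_sq' ?_ (by positivity) |>.2
  nlinarith [sq_nonneg ‖TensorProduct.map (R : H →ₗ[ℂ] H) (Q : K →ₗ[ℂ] K) x‖]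

theorem norm_map_le (S : H →L[ℂ] H) (T : K →L[ℂ] K) (x : H ⊗[ℂ] K) :
    ‖TensorProduct.map (S : H →ₗ[ℂ] H) (T : K →ₗ[ℂ] K) x‖ ≤ (‖S‖ * ‖T‖) * ‖x‖ := by
  have h1 : ∀ y : H ⊗[ℂ] K, ‖TensorProduct.map (S : H →ₗ[ℂ] H)
      ((1 : K →L[ℂ] K) : K →ₗ[ℂ] K) y‖ ≤ ‖S‖ * ‖y‖ := by
    intro y
    obtain ⟨R, hR⟩ := star_mul_self_sq S
    refine norm_map_le_of_isometry_defect (R := R) (Q := 1) (norm_nonneg _) y ?_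
    rw [← LinearMap.add_apply, ← TensorProduct.map_add_left, ← ContinuousLinearMap.toLinearMap_add]
    rw [star_one, one_mul, hR]
    induction y with
    | zero => simp
    | add a b ha hb => rw [map_add, ha, hb, smul_add]
    | tmul a b => simp [Algebra.algebraMap_eq_smul_one, TensorProduct.smul_tmul']
  have h2 : ∀ y : H ⊗[ℂ] K, ‖TensorProduct.map ((1 : H →L[ℂ] H) : H →ₗ[ℂ] H)
      (T : K →ₗ[ℂ] K) y‖ ≤ ‖T‖ * ‖y‖ := by
    intro y
    obtain ⟨R, hR⟩ := star_mul_self_sq T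
    refine norm_map_le_of_isometry_defect (R := 1) (Q := R) (norm_nonneg _) y ?_
    rw [← LinearMap.add_apply, ← TensorProduct.map_add_right, ← ContinuousLinearMap.toLinearMap_add]
    rw [star_one, one_mul, hR]
    induction y with
    | zero => simp
    | add a b ha hb => rw [map_add, ha, hb, smul_add]
    | tmul a b => simp [Algebra.algebraMap_eq_smul_one]
  have e : TensorProduct.map (S : H →ₗ[ℂ] H) (T : K →ₗ[ℂ] K) x =
      TensorProduct.map (S : H →ₗ[ℂ] H) ((1 : K →L[ℂ] K) : K →ₗ[ℂ] K)
        (TensorProduct.map ((1 : H →L[ℂ] H) : H →ₗ[ℂ] H) (T : K →ₗ[ℂ] K) x) := by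
    rw [← LinearMap.comp_apply, ← TensorProduct.map_comp]
    rfl
  rw [e, mul_assoc]
  exact (h1 _).trans (mul_le_mul_of_nonneg_left (h2 x) (norm_nonneg _))

/-- The bounded operator `S ⊗ T` on the Hilbert space tensor product: the continuous extension of
the operator `x ⊗ y ↦ S x ⊗ T y`. -/
def opTensor (S : H →L[ℂ] H) (T : K →L[ℂ] K) : HilbertTensor H K →L[ℂ] HilbertTensor H K :=
  ((TensorProduct.map (S : H →ₗ[ℂ] H) (T : K →ₗ[ℂ] K)).mkContinuous (‖S‖ * ‖T‖)
    (norm_map_le S T)).completion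

theorem opTensor_hilbertTmul (S : H →L[ℂ] H) (T : K →L[ℂ] K) (x : H) (y : K) :
    opTensor S T (hilbertTmul x y) = hilbertTmul (S x) (T y) :=
  ContinuousLinearMap.completion_apply_coe _ _

end HilbertTensor

/-! The spatial tensor product of C⋆-algebras. -/

section SpatialTensor

variable {A B H K : Type*} [CStarAlgebra A] [CStarAlgebra B]
  [NormedAddCommGroup H] [InnerProductSpace ℂ H] [CompleteSpace H]
  [NormedAddCommGroup K] [InnerProductSpace ℂ K] [CompleteSpace K]

/-- The spatial tensor product `A ⊗ B`, for faithful representations `π` of `A` on `H` and `π'`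
of `B` on `K`: the C⋆-algebra of operators on `H ⊗ K` generated by the operators `π a ⊗ π' b`. -/
def spatialTensor (π : A →⋆ₐ[ℂ] (H →L[ℂ] H)) (π' : B →⋆ₐ[ℂ] (K →L[ℂ] K)) :
    StarSubalgebra ℂ (HilbertTensor H K →L[ℂ] HilbertTensor H K) :=
  (StarAlgebra.adjoin ℂ
    (Set.range fun p : A × B => opTensor (π p.1) (π' p.2))).topologicalClosure

/-- The elementary tensor `a ⊗ b` as an element of the spatial tensor product. -/
def spatialTmul (π : A →⋆ₐ[ℂ] (H →L[ℂ] H)) (π' : B →⋆ₐ[ℂ] (K →L[ℂ] K)) (a : A) (b : B) :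
    spatialTensor π π' :=
  ⟨opTensor (π a) (π' b), StarSubalgebra.le_topologicalClosure _
    (StarAlgebra.subset_adjoin ℂ _ (Set.mem_range_self (a, b)))⟩

/-- `ω` is a state of the spatial tensor product `A ⊗ A` (`A` with Weyl unitaries `W`) that assigns
the dispersion-free values `lam` to the relative position and `mu` to the total momentum:
`ω (W(a,0) ⊗ W(-a,0)) = exp (i a lam)` and `ω (W(0,b) ⊗ W(0,b)) = exp (i b mu)`. -/
structure IsEPRState (W : ℝ × ℝ → A) (π₁ : A →⋆ₐ[ℂ] (H →L[ℂ] H)) (π₂ : A →⋆ₐ[ℂ] (K →L[ℂ] K))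
    (lam mu : ℝ) (ω : spatialTensor π₁ π₂ →ₗ[ℂ] ℂ) : Prop where
  isState : IsState ω
  position : ∀ a : ℝ, ω (spatialTmul π₁ π₂ (W (a, 0)) (W (-a, 0))) =
    Complex.exp (Complex.I * a * lam)
  momentum : ∀ b : ℝ, ω (spatialTmul π₁ π₂ (W (0, b)) (W (0, b))) =
    Complex.exp (Complex.I * b * mu)

end SpatialTensor

end

/-! Put V(z) = W(z₁) ⊗ W(z₂) for z in ℝ² ⊕ ℝ². These unitaries satisfy the Weyl relations for the
sum of the two symplectic forms, and their span is dense. The vectors ((a,b),(-a,b)) form a maximal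
isotropic plane, so their V's commute, and the prescribed values extend to a unitary character χ of
this plane.

Existence: χ must be bounded by the operator norm. Conjugating by a suitable V flips the sign of any
chosen nontrivial V(m) in the plane and rescales the others, so averaging isolates the constant term
of a finite sum. Applied to x*x, this bounds the ℓ² norm of the coefficients of x by ‖x‖.
Cauchy–Schwarz then bounds |χ(x)| up to the square root of the number of terms; replacing x by xᵖ,
whose number of terms is polynomial in p, removes that factor (`HasSignFlips.norm_lift_char_le`).
Hahn–Banach gives a contractive unital functional, which is a state.

Uniqueness: unitaries on which a state has modulus one lie in its multiplicative domain, so the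
values on the plane are forced. Off the plane, V(z) is conjugate to -V(z) by a unitary of the plane,
so the state vanishes there (`IsTwoModeWeyl.apply_eq_zero`).

Purity: values of modulus one are extreme in the unit disc, so both parts of a convex decomposition
satisfy the same conditions, and uniqueness applies. -/

noncomputable section

/-! ### Unitary characters dominated by the operator norm -/

section GroupRepresentation

variable {B M : Type*} [CStarAlgebra B] [CommGroup M]

/-- Every nontrivial element of the unitary representation `U` is conjugate to its negative by a
unitary of the algebra whose adjoint action scales each `U m`. -/
def HasSignFlips (U : M →* B) : Prop :=
  ∀ m : M, m ≠ 1 → ∃ v ∈ unitary B, v * U m * star v = -U m ∧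
    ∀ n : M, ∃ c : ℂ, v * U n * star v = c • U n

theorem norm_unitary_conj {v : B} (hv : v ∈ unitary B) (x : B) : ‖v * x * star v‖ = ‖x‖ := by
  rw [CStarRing.norm_mul_mem_unitary _ (Unitary.star_mem hv), CStarRing.norm_mem_unitary_mul _ hv]

/-- Averaging the sum with its conjugate by a sign-flipping unitary removes one term, only rescales
the others, fixes the constant term and does not increase the norm. The induction generalizes over
`c` because of the rescaling. Repetitions in `g` are allowed, as the expansion of x*x requires. -/
theorem HasSignFlips.norm_le_norm_smul_one_add_sum [Nontrivial B] {U : M →* B}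
    (h : HasSignFlips U) {ι : Type*} (s : Finset ι) (g : ι → M) (hg : ∀ i ∈ s, g i ≠ 1) (a : ℂ)
    (c : ι → ℂ) : ‖a‖ ≤ ‖a • (1 : B) + ∑ i ∈ s, c i • U (g i)‖ := by
  classical
  induction s using Finset.induction_on generalizing c with
  | empty => simp [norm_smul]
  | insert j s hj ih =>
    obtain ⟨v, hv, hvj, hvn⟩ := h (g j) (hg j (Finset.mem_insert_self j s))
    choose γ hγ using hvn
    set x : B := a • (1 : B) + ∑ i ∈ insert j s, c i • U (g i) with hx
    have hconj : v * x * star v =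
        a • (1 : B) + (-(c j • U (g j)) + ∑ i ∈ s, (c i * γ (g i)) • U (g i)) := by
      rw [hx, Finset.sum_insert hj]
      simp only [mul_add, add_mul, mul_smul_comm, smul_mul_assoc, Finset.mul_sum, Finset.sum_mul,
        hvj, hγ, mul_one, (Unitary.mem_iff.mp hv).2, smul_neg, smul_smul]
    have hmean : (2⁻¹ : ℂ) • (x + v * x * star v) =
        a • (1 : B) + ∑ i ∈ s, (2⁻¹ * (c i + c i * γ (g i))) • U (g i) := by
      have e : ∑ i ∈ s, (2⁻¹ * (c i + c i * γ (g i))) • U (g i) =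
          (2⁻¹ : ℂ) • (∑ i ∈ s, c i • U (g i) + ∑ i ∈ s, (c i * γ (g i)) • U (g i)) := by
        rw [← Finset.sum_add_distrib, Finset.smul_sum]
        exact Finset.sum_congr rfl fun i _ => by module
      rw [e, hconj, hx, Finset.sum_insert hj]
      module
    calc ‖a‖ ≤ ‖(2⁻¹ : ℂ) • (x + v * x * star v)‖ := by
          rw [hmean]
          exact ih (fun i hi => hg i (Finset.mem_insert_of_mem hi)) _
      _ ≤ 2⁻¹ * (‖x‖ + ‖v * x * star v‖) := by
          rw [norm_smul]
          gcongr
          · simp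
          · exact norm_add_le _ _
      _ = ‖x‖ := by rw [norm_unitary_conj hv]; ring

/-- The left side is the constant term of x*x, coming from the diagonal pairs, and the C⋆-identity
gives ‖x*x‖ = ‖x‖². -/
theorem HasSignFlips.sum_norm_sq_coeff_le [Nontrivial B] {U : M →* B} (h : HasSignFlips U)
    (hU : ∀ m, U m ∈ unitary B) (f : MonoidAlgebra ℂ M) :
    ∑ m ∈ f.coeff.support, ‖f.coeff m‖ ^ 2 ≤ ‖MonoidAlgebra.lift ℂ B M U f‖ ^ 2 := by
  classical
  have hstar : ∀ m, star (U m) = U m⁻¹ := fun m =>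
    left_inv_eq_right_inv (Unitary.mem_iff.mp (hU m)).1 (by rw [← map_mul, mul_inv_cancel, map_one])
  set S := f.coeff.support
  have hx : MonoidAlgebra.lift ℂ B M U f = ∑ m ∈ S, f.coeff m • U m := by
    rw [MonoidAlgebra.lift_apply]; rfl
  have hxx : star (MonoidAlgebra.lift ℂ B M U f) * MonoidAlgebra.lift ℂ B M U f =
      ((∑ m ∈ S, ‖f.coeff m‖ ^ 2 : ℝ) : ℂ) • (1 : B) +
        ∑ p ∈ (S ×ˢ S).filter (fun p => p.1⁻¹ * p.2 ≠ 1),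
          (star (f.coeff p.1) * f.coeff p.2) • U (p.1⁻¹ * p.2) := by
    have e1 : star (MonoidAlgebra.lift ℂ B M U f) * MonoidAlgebra.lift ℂ B M U f =
        ∑ p ∈ S ×ˢ S, (star (f.coeff p.1) * f.coeff p.2) • U (p.1⁻¹ * p.2) := by
      rw [hx, star_sum, Finset.sum_mul_sum, Finset.sum_product]
      refine Finset.sum_congr rfl fun m _ => Finset.sum_congr rfl fun n _ => ?_
      rw [star_smul, hstar, smul_mul_smul_comm, map_mul]
    have e2 : (S ×ˢ S).filter (fun p => p.1⁻¹ * p.2 = 1) = S.image fun m => (m, m) := by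
      ext ⟨m, n⟩
      simp only [Finset.mem_filter, Finset.mem_product, Finset.mem_image, Prod.mk.injEq,
        inv_mul_eq_one]
      constructor
      · rintro ⟨⟨hm, -⟩, rfl⟩
        exact ⟨m, hm, rfl, rfl⟩
      · rintro ⟨k, hk, rfl, rfl⟩
        exact ⟨⟨hk, hk⟩, rfl⟩
    rw [e1, ← Finset.sum_filter_add_sum_filter_not (S ×ˢ S) (fun p => p.1⁻¹ * p.2 = 1), e2,
      Finset.sum_image (by simp)]
    congr 1
    push_cast
    rw [Finset.sum_smul]
    refine Finset.sum_congr rfl fun m _ => ?_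
    rw [inv_mul_cancel, map_one, Complex.star_def, Complex.conj_mul']
  have hle := h.norm_le_norm_smul_one_add_sum
    ((S ×ˢ S).filter fun p => p.1⁻¹ * p.2 ≠ 1) (fun p : M × M => p.1⁻¹ * p.2)
    (fun p hp => (Finset.mem_filter.mp hp).2) ((∑ m ∈ S, ‖f.coeff m‖ ^ 2 : ℝ) : ℂ)
    (fun p => star (f.coeff p.1) * f.coeff p.2)
  rw [← hxx, CStarRing.norm_star_mul_self, Complex.norm_real, ← sq] at hle
  exact (le_abs_self _).trans hle

theorem exists_eq_prod_pow_of_mem_support_pow (f : MonoidAlgebra ℂ M) (p : ℕ) :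
    ∀ m ∈ (f ^ p).coeff.support, ∃ k : M → ℕ, (∀ x, k x ≤ p) ∧
      m = ∏ x ∈ f.coeff.support, x ^ k x := by
  classical
  induction p with
  | zero =>
    intro m hm
    have h1 : m = 1 := by
      by_contra hne
      rw [Finsupp.mem_support_iff, pow_zero, MonoidAlgebra.one_def, MonoidAlgebra.coeff_single,
        Finsupp.single_apply, if_neg (Ne.symm hne)] at hm
      exact hm rfl
    exact ⟨0, by simp, by simp [h1]⟩
  | succ p ih =>
    intro m hm
    rw [pow_succ] at hm
    obtain ⟨y, hy, x, hx, rfl⟩ := Finset.mem_mul.mp (MonoidAlgebra.support_coeff_mul_subset _ _ hm)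
    obtain ⟨k, hk, rfl⟩ := ih y hy
    refine ⟨k + Pi.single x 1, fun z => ?_, ?_⟩
    · have : (Pi.single x 1 : M → ℕ) z ≤ 1 := by
        rw [Pi.single_apply]; split_ifs <;> simp
      exact add_le_add (hk z) this
    · simp only [Pi.add_apply, pow_add, Finset.prod_mul_distrib]
      congr 1
      rw [Finset.prod_eq_single_of_mem x hx]
      · simp
      · intro z _ hz
        simp [hz]

/-- By commutativity, a product of p support elements depends only on the multiplicities, each at
most p. The bound is therefore polynomial in p. -/
theorem card_support_pow_le (f : MonoidAlgebra ℂ M) (p : ℕ) :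
    (f ^ p).coeff.support.card ≤ (p + 1) ^ f.coeff.support.card := by
  classical
  let T := (Fintype.piFinset fun _ : f.coeff.support => Finset.range (p + 1)).image
    fun k => ∏ x : f.coeff.support, (x : M) ^ k x
  have hT : (f ^ p).coeff.support ⊆ T := by
    intro m hm
    obtain ⟨k, hk, rfl⟩ := exists_eq_prod_pow_of_mem_support_pow f p m hm
    refine Finset.mem_image.mpr ⟨fun x => k x, ?_, Finset.prod_coe_sort _ fun x => x ^ k x⟩
    simpa [Fintype.mem_piFinset, Nat.lt_succ_iff] using fun x _ => hk x
  calc _ ≤ T.card := Finset.card_le_card hT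
    _ ≤ _ := Finset.card_image_le
    _ = _ := by simp

theorem le_of_forall_pow_le_poly_mul_pow {a b : ℝ} (hb : 0 ≤ b) (k : ℕ)
    (h : ∀ p : ℕ, a ^ p ≤ (p + 1 : ℝ) ^ k * b ^ p) : a ≤ b := by
  by_contra! hlt
  have ha0 : 0 < a := hb.trans_lt hlt
  have hr : |b / a| < 1 := by
    rw [abs_of_nonneg (by positivity), div_lt_one ha0]; exact hlt
  have ht := (tendsto_pow_const_mul_const_pow_of_abs_lt_one k hr).const_mul ((2 : ℝ) ^ k)
  rw [mul_zero] at ht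
  obtain ⟨p, hp1, hp⟩ := ((ht.eventually_lt_const one_pos).and
    (Filter.eventually_ge_atTop 1)).exists
  have hp' : (1 : ℝ) ≤ p := by exact_mod_cast hp
  have h1 : (1 : ℝ) ≤ (p + 1 : ℝ) ^ k * (b / a) ^ p := by
    rw [div_pow, mul_div_assoc', one_le_div (by positivity)]
    exact h p
  -- Since p ≥ 1, p + 1 ≤ 2p; this is the source of the factor 2ᵏ in `ht`.
  have h2 : (p + 1 : ℝ) ^ k ≤ 2 ^ k * (p : ℝ) ^ k := by
    rw [← mul_pow]; gcongr; linarith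
  have h3 := mul_le_mul_of_nonneg_right h2 (by positivity : 0 ≤ (b / a) ^ p)
  linarith [mul_assoc ((2 : ℝ) ^ k) ((p : ℝ) ^ k) ((b / a) ^ p)]

theorem norm_lift_char_sq_le (χ : M →* ℂ) (hχ : ∀ m, ‖χ m‖ = 1) (f : MonoidAlgebra ℂ M) :
    ‖MonoidAlgebra.lift ℂ ℂ M χ f‖ ^ 2 ≤
      f.coeff.support.card * ∑ m ∈ f.coeff.support, ‖f.coeff m‖ ^ 2 := by
  have h1 : ‖MonoidAlgebra.lift ℂ ℂ M χ f‖ ≤ ∑ m ∈ f.coeff.support, ‖f.coeff m‖ := by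
    rw [MonoidAlgebra.lift_apply]
    refine (norm_sum_le _ _).trans (Finset.sum_le_sum fun m _ => ?_)
    rw [norm_smul, hχ, mul_one]
  calc _ ≤ (∑ m ∈ f.coeff.support, ‖f.coeff m‖) ^ 2 := by gcongr
    _ ≤ _ := sq_sum_le_card_mul_sum_sq

/-- Unitary characters of the commutative group are dominated by the operator norm. -/
theorem HasSignFlips.norm_lift_char_le [Nontrivial B] {U : M →* B} (h : HasSignFlips U)
    (hU : ∀ m, U m ∈ unitary B) (χ : M →* ℂ) (hχ : ∀ m, ‖χ m‖ = 1) (f : MonoidAlgebra ℂ M) :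
    ‖MonoidAlgebra.lift ℂ ℂ M χ f‖ ≤ ‖MonoidAlgebra.lift ℂ B M U f‖ := by
  refine (sq_le_sq₀ (norm_nonneg _) (norm_nonneg _)).mp ?_
  -- Power trick: the comparison for fᵖ loses only the size of its support, a polynomial factor that
  -- disappears after taking p-th roots.
  refine le_of_forall_pow_le_poly_mul_pow (sq_nonneg _) f.coeff.support.card
    fun p => ?_
  calc (‖MonoidAlgebra.lift ℂ ℂ M χ f‖ ^ 2) ^ p = ‖MonoidAlgebra.lift ℂ ℂ M χ (f ^ p)‖ ^ 2 := by
        rw [map_pow, norm_pow, pow_right_comm]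
    _ ≤ _ := norm_lift_char_sq_le χ hχ (f ^ p)
    _ ≤ (p + 1 : ℝ) ^ f.coeff.support.card * ‖MonoidAlgebra.lift ℂ B M U (f ^ p)‖ ^ 2 := by
        gcongr
        · exact_mod_cast card_support_pow_le f p
        · exact h.sum_norm_sq_coeff_le hU _
    _ ≤ _ := by
        gcongr
        rw [map_pow, ← pow_mul, mul_comm, pow_mul]
        gcongr
        exact norm_pow_le _ _

/-- Norm domination makes the character well defined and contractive on the range of the lift of
`U`; Hahn–Banach extends it to `B`. -/
theorem exists_dual_comp_lift [Nontrivial B] {U : M →* B} (h : HasSignFlips U)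
    (hU : ∀ m, U m ∈ unitary B) (χ : M →* ℂ) (hχ : ∀ m, ‖χ m‖ = 1) :
    ∃ φ : StrongDual ℂ B, ‖φ‖ ≤ 1 ∧ ∀ m, φ (U m) = χ m := by
  let Φ := (MonoidAlgebra.lift ℂ B M U).toLinearMap
  let X := (MonoidAlgebra.lift ℂ ℂ M χ).toLinearMap
  have hle : ∀ f, ‖X f‖ ≤ ‖Φ f‖ := h.norm_lift_char_le hU χ hχ
  have hker : LinearMap.ker Φ ≤ LinearMap.ker X := fun f hf => by
    have := hle f
    rw [LinearMap.mem_ker.mp hf, norm_zero] at this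
    exact norm_le_zero_iff.mp this
  let g₀ : LinearMap.range Φ →ₗ[ℂ] ℂ :=
    (LinearMap.ker Φ).liftQ X hker ∘ₗ Φ.quotKerEquivRange.symm.toLinearMap
  have hg₀ : ∀ f, g₀ ⟨Φ f, f, rfl⟩ = X f := fun f => by
    have : Φ.quotKerEquivRange.symm ⟨Φ f, f, rfl⟩ = (LinearMap.ker Φ).mkQ f :=
      Φ.quotKerEquivRange_symm_apply_image f _
    simp [g₀, this]
  have hbound : ∀ y, ‖g₀ y‖ ≤ 1 * ‖y‖ := by
    rintro ⟨_, f, rfl⟩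
    rw [hg₀, one_mul]
    exact hle f
  obtain ⟨φ, hφ, hn⟩ := exists_extension_norm_eq (LinearMap.range Φ) (g₀.mkContinuous 1 hbound)
  refine ⟨φ, hn.le.trans (LinearMap.mkContinuous_norm_le _ zero_le_one _), fun m => ?_⟩
  have e1 : Φ (MonoidAlgebra.single m 1) = U m := by simp [Φ]
  have e2 : X (MonoidAlgebra.single m 1) = χ m := by simp [X]
  rw [← e1, ← e2, ← hg₀]
  exact hφ ⟨Φ (MonoidAlgebra.single m 1), _, rfl⟩

end GroupRepresentation

/-! ### States on C⋆-algebras and their multiplicative domains -/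

section States

variable {B : Type*} [CStarAlgebra B]

/-- A unital contractive functional on a C⋆-algebra is a state. -/
theorem isState_of_norm_le_one (φ : StrongDual ℂ B) (hφ : ‖φ‖ ≤ 1) (h1 : φ 1 = 1) :
    IsState (φ : B →ₗ[ℂ] ℂ) := by
  let := CStarAlgebra.spectralOrder B
  have := CStarAlgebra.spectralOrderedRing B
  have hle : ∀ x, ‖φ x‖ ≤ ‖x‖ := fun x =>
    (φ.le_opNorm x).trans (mul_le_of_le_one_left (norm_nonneg x) hφ)
  have hreal : ∀ x : B, IsSelfAdjoint x → (φ x).im = 0 := by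
    intro x hx
    -- Compare φ(x + it) with ‖x + it‖² = ‖x² + t²‖. The t² terms cancel, so the term 2t Im φ(x)
    -- stays bounded above for all real t, which forces Im φ(x) = 0.
    have key : ∀ t : ℝ, ((φ x).im + t) ^ 2 ≤ ‖x‖ ^ 2 + t ^ 2 * ‖(1 : B)‖ := by
      intro t
      have e1 : φ (x + ((t : ℂ) * Complex.I) • (1 : B)) = φ x + t * Complex.I := by
        simp [h1]
      have e2 : star (x + ((t : ℂ) * Complex.I) • (1 : B)) * (x + ((t : ℂ) * Complex.I) • (1 : B)) =
          x * x + ((t : ℂ) ^ 2) • (1 : B) := by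
        rw [star_add, hx.star_eq, star_smul, star_one]
        simp only [add_mul, mul_add, smul_mul_assoc, mul_smul_comm, one_mul, mul_one,
          Complex.star_def, map_mul, Complex.conj_ofReal, Complex.conj_I]
        have e3 : (t : ℂ) * -Complex.I * (t * Complex.I) = (t : ℂ) ^ 2 := by
          linear_combination (-(t : ℂ) ^ 2) * Complex.I_sq
        rw [← e3]
        module
      have h2 := hle (x + ((t : ℂ) * Complex.I) • (1 : B))
      calc ((φ x).im + t) ^ 2 ≤ ‖φ x + t * Complex.I‖ ^ 2 := by
            rw [Complex.sq_norm, Complex.normSq_apply]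
            simp
            nlinarith [sq_nonneg (φ x).re]
        _ ≤ ‖x + ((t : ℂ) * Complex.I) • (1 : B)‖ ^ 2 := by rw [← e1]; gcongr
        _ = ‖x * x + ((t : ℂ) ^ 2) • (1 : B)‖ := by rw [← e2, CStarRing.norm_star_mul_self, sq]
        _ ≤ ‖x‖ ^ 2 + t ^ 2 * ‖(1 : B)‖ := by
            refine (norm_add_le _ _).trans (add_le_add ?_ (le_of_eq ?_))
            · rw [sq]; exact norm_mul_le _ _
            · rw [norm_smul]; simp
    have hone : ‖(1 : B)‖ = 1 := by
      have : Nontrivial B := ⟨⟨1, 0, fun h => by simp [h] at h1⟩⟩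
      exact norm_one
    simp only [hone, mul_one] at key
    by_contra hne
    -- This t makes the cross term equal to ‖x‖² + 1, exceeding the bound ‖x‖².
    have := key ((‖x‖ ^ 2 + 1) / (2 * (φ x).im))
    have e : 2 * (φ x).im * ((‖x‖ ^ 2 + 1) / (2 * (φ x).im)) = ‖x‖ ^ 2 + 1 := by
      field_simp
    nlinarith [sq_nonneg (φ x).im]
  refine ⟨fun x => ?_, h1⟩
  set y := star x * x with hy
  have hy0 : 0 ≤ y := star_mul_self_nonneg x
  have hysa : IsSelfAdjoint y := IsSelfAdjoint.star_mul_self x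
  -- For y ≥ 0, contractivity then gives ‖y‖ - Re φ(y) ≤ ‖y‖, that is, Re φ(y) ≥ 0.
  have hdom : ‖algebraMap ℝ B ‖y‖ - y‖ ≤ ‖y‖ := by
    have hb : algebraMap ℝ B ‖y‖ - y ≤ algebraMap ℝ B ‖y‖ := sub_le_self _ hy0
    have hb0 : 0 ≤ algebraMap ℝ B ‖y‖ - y := sub_nonneg.mpr hysa.le_algebraMap_norm_self
    exact (CStarAlgebra.norm_le_iff_le_algebraMap _ (norm_nonneg y) hb0).mpr hb
  have h3 := (Complex.abs_re_le_norm _).trans ((hle _).trans hdom)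
  have e4 : (φ (algebraMap ℝ B ‖y‖ - y)).re = ‖y‖ - (φ y).re := by
    rw [map_sub, Algebra.algebraMap_eq_smul_one, ← Complex.coe_smul, map_smul, h1]
    simp
  rw [e4] at h3
  have h5 : 0 ≤ (φ y).re := by linarith [(abs_le.mp h3).2]
  exact Complex.le_def.mpr ⟨h5, (hreal y hysa).symm⟩

variable {ω : B →ₗ[ℂ] ℂ}

/-- A state as a positive linear map for the spectral order. -/
theorem IsState.exists_positiveLinearMap (h : IsState ω) :
    letI := CStarAlgebra.spectralOrder B
    ∃ f : B →ₚ[ℂ] ℂ, ∀ x, f x = ω x := by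
  let := CStarAlgebra.spectralOrder B
  have := CStarAlgebra.spectralOrderedRing B
  refine ⟨PositiveLinearMap.mk₀ ω fun x hx => ?_, fun x => rfl⟩
  obtain ⟨y, rfl⟩ := CStarAlgebra.nonneg_iff_eq_star_mul_self.mp hx
  exact h.nonneg y

theorem IsState.continuous (h : IsState ω) : Continuous ω := by
  let := CStarAlgebra.spectralOrder B
  have := CStarAlgebra.spectralOrderedRing B
  obtain ⟨f, hf⟩ := h.exists_positiveLinearMap
  have : (ω : B → ℂ) = f := funext fun x => (hf x).symm
  rw [this]
  exact map_continuous f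

theorem IsState.map_star (h : IsState ω) (x : B) : ω (star x) = star (ω x) := by
  let := CStarAlgebra.spectralOrder B
  have := CStarAlgebra.spectralOrderedRing B
  obtain ⟨f, hf⟩ := h.exists_positiveLinearMap
  rw [← hf, ← hf, StarHomClass.map_star]

/-- Cauchy–Schwarz in the pre-GNS space of the state. -/
theorem IsState.norm_star_mul_sq_le (h : IsState ω) (x y : B) :
    ‖ω (star x * y)‖ ^ 2 ≤ ‖ω (star x * x)‖ * ‖ω (star y * y)‖ := by
  let := CStarAlgebra.spectralOrder B
  have := CStarAlgebra.spectralOrderedRing B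
  obtain ⟨f, hf⟩ := h.exists_positiveLinearMap
  have hcs := norm_inner_le_norm (𝕜 := ℂ) (f.toPreGNS x) (f.toPreGNS y)
  have hsq : ∀ z : B, ‖ω (star z * z)‖ = ‖f.toPreGNS z‖ ^ 2 := fun z => by
    have := f.preGNS_norm_sq (f.toPreGNS z)
    rw [PositiveLinearMap.ofPreGNS_toPreGNS] at this
    rw [← hf, ← this]
    simp
  rw [hsq, hsq, ← mul_pow, ← hf]
  exact pow_le_pow_left₀ (norm_nonneg _) hcs 2

theorem IsState.norm_unitary_le (h : IsState ω) {u : B} (hu : u ∈ unitary B) : ‖ω u‖ ≤ 1 := by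
  have := h.norm_star_mul_sq_le 1 u
  simp only [star_one, one_mul, mul_one, (Unitary.mem_iff.mp hu).1, h.map_one, norm_one] at this
  nlinarith [norm_nonneg (ω u)]

/-- Unitaries on which a state has modulus one lie in its multiplicative domain. -/
theorem IsState.map_mul_unitary (h : IsState ω) {u : B} (hu : u ∈ unitary B) (h1 : ‖ω u‖ = 1)
    (x : B) : ω (x * u) = ω x * ω u := by
  -- Here ω(y*y) = 1 - |ω(u)|² = 0, so Cauchy–Schwarz gives ω(xy) = 0.
  set y : B := u - ω u • (1 : B) with hy
  have hyy : ω (star y * y) = 0 := by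
    have e : star y * y = (1 + (star (ω u) * ω u)) • (1 : B) - ω u • star u - star (ω u) • u := by
      simp only [hy, star_sub, star_smul, star_one, sub_mul, mul_sub, smul_mul_assoc,
        mul_smul_comm, one_mul, mul_one, (Unitary.mem_iff.mp hu).1]
      module
    have e2 : star (ω u) * ω u = 1 := by
      rw [Complex.star_def, Complex.conj_mul', h1]; simp
    rw [e]
    simp only [map_sub, map_smul, smul_eq_mul, h.map_one, h.map_star]
    linear_combination - e2
  have := h.norm_star_mul_sq_le (star x) y
  rw [hyy, norm_zero, mul_zero, star_star] at this
  have h0 : ω (x * y) = 0 := by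
    rw [← norm_eq_zero]
    exact pow_eq_zero_iff two_ne_zero |>.mp (le_antisymm this (sq_nonneg _))
  rw [hy, mul_sub, map_sub, mul_smul_comm, mul_one, map_smul, sub_eq_zero] at h0
  rw [h0, smul_eq_mul, mul_comm]

theorem IsState.map_unitary_mul (h : IsState ω) {u : B} (hu : u ∈ unitary B) (h1 : ‖ω u‖ = 1)
    (x : B) : ω (u * x) = ω u * ω x := by
  have := h.map_mul_unitary (Unitary.star_mem hu) (by rw [h.map_star, norm_star, h1]) (star x)
  rw [← star_mul, h.map_star, h.map_star, h.map_star] at this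
  have h2 := congrArg star this
  simpa [mul_comm] using h2

end States

/-! ### EPR states on the two-mode Weyl algebra -/

section TwoModeWeyl

variable {B : Type*} [CStarAlgebra B]

/-- The symplectic form on `ℝ² ⊕ ℝ²`. -/
def twoModeForm (z w : (ℝ × ℝ) × (ℝ × ℝ)) : ℝ := weylForm z.1 w.1 + weylForm z.2 w.2

/-- The unitaries `V z` generate `B` and satisfy the Weyl relations over `ℝ² ⊕ ℝ²`. -/
structure IsTwoModeWeyl (V : (ℝ × ℝ) × (ℝ × ℝ) → B) : Prop where
  nontrivial : Nontrivial B
  unitary : ∀ z, V z ∈ unitary B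
  weyl : ∀ z w, V z * V w = Complex.exp (Complex.I * (twoModeForm z w : ℂ)) • V (z + w)
  dense_span : Dense (Submodule.span ℂ (Set.range V) : Set B)

/-- The parametrization of the isotropic plane of relative position and total momentum. -/
def eprVector (x : ℝ × ℝ) : (ℝ × ℝ) × (ℝ × ℝ) := ((x.1, x.2), (-x.1, x.2))

/-- `ω` is a state with dispersion-free values `lam`, `mu` of relative position and total
momentum. -/
structure IsTwoModeEPR (V : (ℝ × ℝ) × (ℝ × ℝ) → B) (lam mu : ℝ) (ω : B →ₗ[ℂ] ℂ) : Prop where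
  isState : IsState ω
  position : ∀ a : ℝ, ω (V (eprVector (a, 0))) = Complex.exp (Complex.I * a * lam)
  momentum : ∀ b : ℝ, ω (V (eprVector (0, b))) = Complex.exp (Complex.I * b * mu)

/-- The character `(a, b) ↦ exp (i (a lam + b mu))`. -/
def eprChar (lam mu : ℝ) : Multiplicative (ℝ × ℝ) →* ℂ where
  toFun x := Complex.exp (((x.toAdd.1 * lam + x.toAdd.2 * mu : ℝ) : ℂ) * Complex.I)
  map_one' := by simp
  map_mul' x y := by
    rw [← Complex.exp_add]
    congr 1
    simp only [toAdd_mul, Prod.fst_add, Prod.snd_add]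
    push_cast
    ring

theorem norm_eprChar (lam mu : ℝ) (x : Multiplicative (ℝ × ℝ)) : ‖eprChar lam mu x‖ = 1 :=
  Complex.norm_exp_ofReal_mul_I _

theorem twoModeForm_eprVector (x y : ℝ × ℝ) : twoModeForm (eprVector x) (eprVector y) = 0 := by
  simp only [twoModeForm, weylForm, eprVector]
  ring

theorem eprVector_add (x y : ℝ × ℝ) : eprVector (x + y) = eprVector x + eprVector y := by
  ext <;> simp [eprVector]
  ring

theorem eprVector_zero : eprVector 0 = 0 := by
  ext <;> simp [eprVector]


namespace IsTwoModeWeyl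

variable {V : (ℝ × ℝ) × (ℝ × ℝ) → B}

theorem zero (hV : IsTwoModeWeyl V) : V 0 = 1 := by
  have h := hV.weyl 0 0
  simp only [twoModeForm, weylForm, Prod.fst_zero, Prod.snd_zero, add_zero, mul_zero, sub_zero,
    Complex.ofReal_zero, Complex.exp_zero, one_smul] at h
  calc V 0 = star (V 0) * (V 0 * V 0) := by
        rw [← mul_assoc, (Unitary.mem_iff.mp (hV.unitary 0)).1, one_mul]
    _ = 1 := by rw [h, (Unitary.mem_iff.mp (hV.unitary 0)).1]

theorem mul_eq_smul_mul (hV : IsTwoModeWeyl V) (z w : (ℝ × ℝ) × (ℝ × ℝ)) :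
    V z * V w = Complex.exp (Complex.I * ((2 * twoModeForm z w : ℝ) : ℂ)) • (V w * V z) := by
  rw [hV.weyl, hV.weyl, smul_smul, ← Complex.exp_add, add_comm w z]
  congr 2
  simp only [twoModeForm, weylForm]
  push_cast
  ring

theorem conj_eq_smul (hV : IsTwoModeWeyl V) (z w : (ℝ × ℝ) × (ℝ × ℝ)) :
    V z * V w * star (V z) =
      Complex.exp (Complex.I * ((2 * twoModeForm z w : ℝ) : ℂ)) • V w := by
  rw [hV.mul_eq_smul_mul, smul_mul_assoc, mul_assoc, (Unitary.mem_iff.mp (hV.unitary z)).2,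
    mul_one]

theorem conj_eq_neg (hV : IsTwoModeWeyl V) {z w : (ℝ × ℝ) × (ℝ × ℝ)}
    (h : 2 * twoModeForm z w = Real.pi) :
    V z * V w * star (V z) = -V w := by
  rw [hV.conj_eq_smul, h, mul_comm, Complex.exp_pi_mul_I, neg_one_smul]

theorem mul_eprVector (hV : IsTwoModeWeyl V) (x y : ℝ × ℝ) :
    V (eprVector x) * V (eprVector y) = V (eprVector (x + y)) := by
  rw [hV.weyl, twoModeForm_eprVector, eprVector_add]
  simp

/-- The commuting unitaries of relative position and total momentum. -/
def eprHom (hV : IsTwoModeWeyl V) : Multiplicative (ℝ × ℝ) →* B where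
  toFun x := V (eprVector x.toAdd)
  map_one' := by rw [toAdd_one, eprVector_zero, hV.zero]
  map_mul' x y := by rw [toAdd_mul, hV.mul_eprVector]

theorem hasSignFlips_eprHom (hV : IsTwoModeWeyl V) : HasSignFlips hV.eprHom := by
  intro m hm
  obtain ⟨a, b⟩ := m
  have hr : a ^ 2 + b ^ 2 ≠ 0 := by
    intro h0
    have ha : a = 0 := by nlinarith [sq_nonneg a, sq_nonneg b]
    have hb : b = 0 := by nlinarith [sq_nonneg a, sq_nonneg b]
    subst ha hb
    exact hm rfl
  -- Conjugation by V(z) multiplies V(w) by exp(2iσ(z,w)), so 2σ = π is wanted. The first mode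
  -- suffices: it already carries all of (a,b), so rotating (a,b) by a right angle and rescaling
  -- works.
  let z : (ℝ × ℝ) × (ℝ × ℝ) :=
    ((Real.pi * b / (a ^ 2 + b ^ 2), -(Real.pi * a) / (a ^ 2 + b ^ 2)), (0, 0))
  refine ⟨V z, hV.unitary z, hV.conj_eq_neg ?_, fun n => ⟨_, hV.conj_eq_smul z _⟩⟩
  change 2 * twoModeForm z (eprVector (a, b)) = Real.pi
  simp only [twoModeForm, weylForm, eprVector, z]
  field_simp
  ring

theorem exists_isTwoModeEPR (hV : IsTwoModeWeyl V) (lam mu : ℝ) :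
    ∃ ω : B →ₗ[ℂ] ℂ, IsTwoModeEPR V lam mu ω := by
  have := hV.nontrivial
  obtain ⟨φ, hφ, hχ⟩ := exists_dual_comp_lift hV.hasSignFlips_eprHom
    (fun m => hV.unitary (eprVector m.toAdd)) (eprChar lam mu) (norm_eprChar lam mu)
  have h1 : φ 1 = 1 := by
    have := hχ 1
    rwa [MonoidHom.map_one, MonoidHom.map_one] at this
  refine ⟨φ, isState_of_norm_le_one φ hφ h1, fun a => ?_, fun b => ?_⟩
  · refine (hχ (Multiplicative.ofAdd (a, 0))).trans ?_
    simp only [eprChar, MonoidHom.coe_mk, OneHom.coe_mk, toAdd_ofAdd]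
    congr 1
    push_cast
    ring
  · refine (hχ (Multiplicative.ofAdd (0, b))).trans ?_
    simp only [eprChar, MonoidHom.coe_mk, OneHom.coe_mk, toAdd_ofAdd]
    congr 1
    push_cast
    ring

variable {lam mu : ℝ} {ω ω' : B →ₗ[ℂ] ℂ}

theorem apply_eprVector (hV : IsTwoModeWeyl V) (h : IsTwoModeEPR V lam mu ω) (x : ℝ × ℝ) :
    ω (V (eprVector x)) = eprChar lam mu (Multiplicative.ofAdd x) := by
  have hx : V (eprVector x) = V (eprVector (x.1, 0)) * V (eprVector (0, x.2)) := by
    rw [hV.mul_eprVector]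
    simp
  have hn : ‖ω (V (eprVector (0, x.2)))‖ = 1 := by
    rw [h.momentum, mul_assoc, mul_comm, ← Complex.ofReal_mul, Complex.norm_exp_ofReal_mul_I]
  rw [hx, h.isState.map_mul_unitary (hV.unitary _) hn, h.position, h.momentum, ← Complex.exp_add]
  simp only [eprChar, MonoidHom.coe_mk, OneHom.coe_mk, toAdd_ofAdd]
  congr 1
  push_cast
  ring

/-- The isotropic plane is maximal, so some V(x) in it conjugates V(z) to -V(z). As V(x) lies in the
multiplicative domain, conjugation by it does not change ω, whence ω(V z) = -ω(V z). -/
theorem apply_eq_zero (hV : IsTwoModeWeyl V) (h : IsTwoModeEPR V lam mu ω)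
    {z : (ℝ × ℝ) × (ℝ × ℝ)}
    (hz : ∀ x, z ≠ eprVector x) : ω (V z) = 0 := by
  obtain ⟨⟨p, q⟩, ⟨p', q'⟩⟩ := z
  have hr : (p + p') ^ 2 + (q' - q) ^ 2 ≠ 0 := by
    intro h0
    have hp : p + p' = 0 := by nlinarith [sq_nonneg (p + p'), sq_nonneg (q' - q)]
    have hq : q' - q = 0 := by nlinarith [sq_nonneg (p + p'), sq_nonneg (q' - q)]
    refine hz (p, q) ?_
    simp only [eprVector, Prod.mk.injEq, true_and]
    exact ⟨by linarith, by linarith⟩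
  -- The plane is p + p' = 0 = q' - q, and 2σ(eprVector x, z) = -x₁(q' - q) - x₂(p + p'); this x
  -- makes the value π.
  let x : ℝ × ℝ := (-(Real.pi * (q' - q)) / ((p + p') ^ 2 + (q' - q) ^ 2),
    -(Real.pi * (p + p')) / ((p + p') ^ 2 + (q' - q) ^ 2))
  have hx : 2 * twoModeForm (eprVector x) ((p, q), (p', q')) = Real.pi := by
    simp only [twoModeForm, weylForm, eprVector, x]
    field_simp
    ring
  have hn : ‖ω (V (eprVector x))‖ = 1 := by
    rw [hV.apply_eprVector h, norm_eprChar]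
  have hconj := congrArg ω (hV.conj_eq_neg hx)
  rw [h.isState.map_mul_unitary (Unitary.star_mem (hV.unitary _))
      (by rw [h.isState.map_star, norm_star, hn]),
    h.isState.map_unitary_mul (hV.unitary _) hn, h.isState.map_star, map_neg,
    mul_right_comm, Complex.star_def, Complex.mul_conj', hn] at hconj
  simp only [Complex.ofReal_one, one_pow, one_mul] at hconj
  linear_combination hconj / 2

theorem eq_of_isTwoModeEPR (hV : IsTwoModeWeyl V) (h : IsTwoModeEPR V lam mu ω)
    (h' : IsTwoModeEPR V lam mu ω') : ω = ω' := by
  let f : StrongDual ℂ B := ⟨ω, h.isState.continuous⟩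
  let f' : StrongDual ℂ B := ⟨ω', h'.isState.continuous⟩
  have hff : f = f' := by
    refine ContinuousLinearMap.ext_on hV.dense_span ?_
    rintro _ ⟨z, rfl⟩
    change ω (V z) = ω' (V z)
    by_cases hz : ∃ x, z = eprVector x
    · obtain ⟨x, rfl⟩ := hz
      rw [hV.apply_eprVector h, hV.apply_eprVector h']
    · rw [hV.apply_eq_zero h (not_exists.mp hz), hV.apply_eq_zero h' (not_exists.mp hz)]
  exact congrArg ContinuousLinearMap.toLinearMap hff

/-- States are bounded by one on unitaries, so by strict convexity of the disc a mixture of modulus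
one forces equal values. A component of ω thus takes the EPR values and equals ω by uniqueness. -/
theorem isPureState (hV : IsTwoModeWeyl V) (h : IsTwoModeEPR V lam mu ω) : IsPureState ω := by
  refine mem_extremePoints_iff_left.mpr ⟨h.isState, ?_⟩
  rintro ω₁ h₁ ω₂ h₂ ⟨s, t, hs, ht, hst, rfl⟩
  have key : ∀ u ∈ _root_.unitary B, ‖(s • ω₁ + t • ω₂) u‖ = 1 → ω₁ u = (s • ω₁ + t • ω₂) u := by
    intro u hu hn
    have heq : ω₁ u = ω₂ u := by
      by_contra hne
      exact (norm_combo_lt_of_ne (IsState.norm_unitary_le h₁ hu) (IsState.norm_unitary_le h₂ hu)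
        hne hs ht hst).ne hn
    rw [LinearMap.add_apply, LinearMap.smul_apply, LinearMap.smul_apply, ← heq, ← add_smul, hst,
      one_smul]
  refine hV.eq_of_isTwoModeEPR ⟨h₁, fun a => ?_, fun b => ?_⟩ h
  · rw [key _ (hV.unitary _) (by rw [hV.apply_eprVector h, norm_eprChar]), h.position]
  · rw [key _ (hV.unitary _) (by rw [hV.apply_eprVector h, norm_eprChar]), h.momentum]

end IsTwoModeWeyl

end TwoModeWeyl

/-! ### Algebra of operator tensor products -/

section OperatorTensor

variable {H K : Type*} [NormedAddCommGroup H] [InnerProductSpace ℂ H]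
  [NormedAddCommGroup K] [InnerProductSpace ℂ K]

theorem hilbertTmul_add_left (x x' : H) (y : K) :
    hilbertTmul (x + x') y = hilbertTmul x y + hilbertTmul x' y := by
  unfold hilbertTmul
  rw [TensorProduct.add_tmul]
  exact UniformSpace.Completion.coe_add _ _

theorem hilbertTmul_add_right (x : H) (y y' : K) :
    hilbertTmul x (y + y') = hilbertTmul x y + hilbertTmul x y' := by
  unfold hilbertTmul
  rw [TensorProduct.tmul_add]
  exact UniformSpace.Completion.coe_add _ _

theorem hilbertTmul_smul_left (c : ℂ) (x : H) (y : K) :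
    hilbertTmul (c • x) y = c • hilbertTmul x y := by
  unfold hilbertTmul
  rw [← TensorProduct.smul_tmul']
  exact UniformSpace.Completion.coe_smul _ _

theorem hilbertTmul_smul_right (c : ℂ) (x : H) (y : K) :
    hilbertTmul x (c • y) = c • hilbertTmul x y := by
  unfold hilbertTmul
  rw [TensorProduct.tmul_smul]
  exact UniformSpace.Completion.coe_smul _ _

theorem hilbertTensor_op_ext {S T : HilbertTensor H K →L[ℂ] HilbertTensor H K}
    (h : ∀ x y, S (hilbertTmul x y) = T (hilbertTmul x y)) : S = T :=
  ContinuousLinearMap.ext_on dense_span_hilbertTmul (by rintro _ ⟨p, rfl⟩; exact h p.1 p.2)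

theorem hilbertTensor_vector_ext {v w : HilbertTensor H K}
    (h : ∀ x y, inner ℂ (hilbertTmul x y) v = inner ℂ (hilbertTmul x y) w) : v = w := by
  refine dense_span_hilbertTmul.eq_of_inner_right ℂ fun u hu => ?_
  induction hu using Submodule.span_induction with
  | mem u hu => obtain ⟨p, rfl⟩ := hu; exact h p.1 p.2
  | zero => simp
  | add a b _ _ ha hb => rw [inner_add_left, inner_add_left, ha, hb]
  | smul c a _ ha => rw [inner_smul_left, inner_smul_left, ha]

variable [CompleteSpace H] [CompleteSpace K]

theorem opTensor_one : opTensor (1 : H →L[ℂ] H) (1 : K →L[ℂ] K) = 1 :=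
  hilbertTensor_op_ext fun x y => opTensor_hilbertTmul _ _ x y

theorem opTensor_mul (S S' : H →L[ℂ] H) (T T' : K →L[ℂ] K) :
    opTensor (S * S') (T * T') = opTensor S T * opTensor S' T' :=
  hilbertTensor_op_ext fun x y => by
    simp [opTensor_hilbertTmul]

theorem opTensor_add_left (S S' : H →L[ℂ] H) (T : K →L[ℂ] K) :
    opTensor (S + S') T = opTensor S T + opTensor S' T :=
  hilbertTensor_op_ext fun x y => by
    simp [opTensor_hilbertTmul, hilbertTmul_add_left]

theorem opTensor_add_right (S : H →L[ℂ] H) (T T' : K →L[ℂ] K) :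
    opTensor S (T + T') = opTensor S T + opTensor S T' :=
  hilbertTensor_op_ext fun x y => by
    simp [opTensor_hilbertTmul, hilbertTmul_add_right]

theorem opTensor_smul_left (c : ℂ) (S : H →L[ℂ] H) (T : K →L[ℂ] K) :
    opTensor (c • S) T = c • opTensor S T :=
  hilbertTensor_op_ext fun x y => by
    simp [opTensor_hilbertTmul, hilbertTmul_smul_left]

theorem opTensor_smul_right (c : ℂ) (S : H →L[ℂ] H) (T : K →L[ℂ] K) :
    opTensor S (c • T) = c • opTensor S T :=
  hilbertTensor_op_ext fun x y => by
    simp [opTensor_hilbertTmul, hilbertTmul_smul_right]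

theorem star_opTensor (S : H →L[ℂ] H) (T : K →L[ℂ] K) :
    star (opTensor S T) = opTensor (star S) (star T) :=
  hilbertTensor_op_ext fun x y => hilbertTensor_vector_ext fun x' y' => by
    rw [ContinuousLinearMap.star_eq_adjoint, ContinuousLinearMap.adjoint_inner_right,
      opTensor_hilbertTmul, opTensor_hilbertTmul, inner_hilbertTmul, inner_hilbertTmul,
      ContinuousLinearMap.star_eq_adjoint, ContinuousLinearMap.star_eq_adjoint,
      ContinuousLinearMap.adjoint_inner_right, ContinuousLinearMap.adjoint_inner_right]

variable (H K) in
/-- The ampliation `S ↦ S ⊗ 1`. -/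
def leftAmpliation : (H →L[ℂ] H) →⋆ₐ[ℂ] (HilbertTensor H K →L[ℂ] HilbertTensor H K) where
  toFun S := opTensor S 1
  map_one' := opTensor_one
  map_mul' S S' := by rw [← opTensor_mul, one_mul]
  map_zero' := by simpa using opTensor_smul_left (0 : ℂ) (0 : H →L[ℂ] H) (1 : K →L[ℂ] K)
  map_add' S S' := opTensor_add_left S S' 1
  commutes' c := by
    rw [Algebra.algebraMap_eq_smul_one, Algebra.algebraMap_eq_smul_one, opTensor_smul_left,
      opTensor_one]
  map_star' S := by rw [star_opTensor, star_one]

variable (H K) in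
/-- The ampliation `T ↦ 1 ⊗ T`. -/
def rightAmpliation : (K →L[ℂ] K) →⋆ₐ[ℂ] (HilbertTensor H K →L[ℂ] HilbertTensor H K) where
  toFun T := opTensor 1 T
  map_one' := opTensor_one
  map_mul' T T' := by rw [← opTensor_mul, one_mul]
  map_zero' := by simpa using opTensor_smul_right (0 : ℂ) (1 : H →L[ℂ] H) (0 : K →L[ℂ] K)
  map_add' T T' := opTensor_add_right 1 T T'
  commutes' c := by
    rw [Algebra.algebraMap_eq_smul_one, Algebra.algebraMap_eq_smul_one, opTensor_smul_right,
      opTensor_one]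
  map_star' T := by rw [star_opTensor, star_one]

theorem opTensor_eq_ampliation_mul (S : H →L[ℂ] H) (T : K →L[ℂ] K) :
    opTensor S T = leftAmpliation H K S * rightAmpliation H K T := by
  refine Eq.trans ?_ (opTensor_mul S 1 1 T)
  rw [mul_one, one_mul]

end OperatorTensor

/-! ### The spatial tensor product as a two-mode Weyl algebra -/

section WeylTensor

/-- A family of elements closed under products and adjoints up to scalars spans the `*`-algebra it
generates. -/
theorem adjoin_range_le_span {B G : Type*} [Ring B] [StarRing B] [Algebra ℂ B] [StarModule ℂ B]
    [AddGroup G] (V : G → B) (hone : V 0 = 1) (hstar : ∀ z, star (V z) = V (-z))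
    (hmul : ∀ z w, ∃ c : ℂ, V z * V w = c • V (z + w)) :
    ((StarAlgebra.adjoin ℂ (Set.range V) : StarSubalgebra ℂ B) : Set B) ⊆
      Submodule.span ℂ (Set.range V) := by
  intro x hx
  have hx' : x ∈ Submodule.span ℂ
      (Submonoid.closure (Set.range V ∪ star (Set.range V)) : Set B) := by
    rw [← StarAlgebra.adjoin_eq_span]
    exact hx
  refine Submodule.span_le.mpr (fun y hy => ?_) hx'
  have key : ∃ (c : ℂ) (z : G), y = c • V z := by
    induction hy using Submonoid.closure_induction with
    | mem y hy =>
      rcases hy with ⟨z, rfl⟩ | ⟨z, hz⟩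
      · exact ⟨1, z, (one_smul _ _).symm⟩
      · exact ⟨1, -z, by rw [one_smul, ← hstar, hz, star_star]⟩
    | one => exact ⟨1, 0, by rw [one_smul, hone]⟩
    | mul a b _ _ ha hb =>
      obtain ⟨c, z, rfl⟩ := ha
      obtain ⟨d, w, rfl⟩ := hb
      obtain ⟨e, he⟩ := hmul z w
      exact ⟨c * d * e, z + w, by rw [smul_mul_smul_comm, he, smul_smul]⟩
  obtain ⟨c, z, rfl⟩ := key
  exact Submodule.smul_mem _ _ (Submodule.subset_span ⟨z, rfl⟩)

theorem IsWeylAlgebra.zero {A : Type*} [CStarAlgebra A] {W : ℝ × ℝ → A} (hW : IsWeylAlgebra W) :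
    W 0 = 1 := by
  have h := hW.weyl 0 0
  simp only [weylForm, Prod.fst_zero, Prod.snd_zero, add_zero, mul_zero, sub_zero,
    Complex.ofReal_zero, Complex.exp_zero, one_smul] at h
  calc W 0 = star (W 0) * (W 0 * W 0) := by
        rw [← mul_assoc, (Unitary.mem_iff.mp (hW.unitary 0)).1, one_mul]
    _ = 1 := by rw [h, (Unitary.mem_iff.mp (hW.unitary 0)).1]

variable {A H K : Type*} [CStarAlgebra A]
  [NormedAddCommGroup H] [InnerProductSpace ℂ H] [CompleteSpace H]
  [NormedAddCommGroup K] [InnerProductSpace ℂ K] [CompleteSpace K]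
  (π₁ : A →⋆ₐ[ℂ] (H →L[ℂ] H)) (π₂ : A →⋆ₐ[ℂ] (K →L[ℂ] K))

/-- The C⋆-algebra structure of the spatial tensor product, as a closed `*`-subalgebra. -/
abbrev spatialTensorCStarAlgebra : CStarAlgebra (spatialTensor π₁ π₂) :=
  StarSubalgebra.cstarAlgebra _ (h_closed := StarSubalgebra.isClosed_topologicalClosure _)

attribute [local instance] spatialTensorCStarAlgebra

variable {W : ℝ × ℝ → A}

theorem spatialTmul_weyl (hW : IsWeylAlgebra W) (z w : (ℝ × ℝ) × (ℝ × ℝ)) :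
    spatialTmul π₁ π₂ (W z.1) (W z.2) * spatialTmul π₁ π₂ (W w.1) (W w.2) =
      Complex.exp (Complex.I * (twoModeForm z w : ℂ)) •
        spatialTmul π₁ π₂ (W (z + w).1) (W (z + w).2) := by
  refine Subtype.ext ?_
  change opTensor (π₁ (W z.1)) (π₂ (W z.2)) * opTensor (π₁ (W w.1)) (π₂ (W w.2)) =
    Complex.exp (Complex.I * (twoModeForm z w : ℂ)) •
      opTensor (π₁ (W (z + w).1)) (π₂ (W (z + w).2))
  rw [← opTensor_mul, ← map_mul, ← map_mul, hW.weyl, hW.weyl, map_smul, map_smul,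
    opTensor_smul_left, opTensor_smul_right, smul_smul, ← Complex.exp_add, twoModeForm]
  congr 2
  push_cast
  ring

theorem spatialTmul_mem_unitary {a b : A} (ha : a ∈ unitary A) (hb : b ∈ unitary A) :
    spatialTmul π₁ π₂ a b ∈ unitary (spatialTensor π₁ π₂) := by
  obtain ⟨ha1, ha2⟩ := Unitary.mem_iff.mp ha
  obtain ⟨hb1, hb2⟩ := Unitary.mem_iff.mp hb
  refine Unitary.mem_iff.mpr ⟨Subtype.ext ?_, Subtype.ext ?_⟩
  · change star (opTensor (π₁ a) (π₂ b)) * opTensor (π₁ a) (π₂ b) = 1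
    rw [star_opTensor, ← opTensor_mul, ← map_star, ← map_star, ← map_mul, ← map_mul, ha1, hb1,
      map_one, map_one, opTensor_one]
  · change opTensor (π₁ a) (π₂ b) * star (opTensor (π₁ a) (π₂ b)) = 1
    rw [star_opTensor, ← opTensor_mul, ← map_star, ← map_star, ← map_mul, ← map_mul, ha2, hb2,
      map_one, map_one, opTensor_one]

open scoped CStarAlgebra in
/-- A C⋆-subalgebra containing the images of the Weyl unitaries contains the image of `A`. -/
theorem IsWeylAlgebra.map_mem {B : Type*} [CStarAlgebra B] (hW : IsWeylAlgebra W)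
    (ρ : A →⋆ₐ[ℂ] B) (T : StarSubalgebra ℂ B) (hT : IsClosed (T : Set B))
    (h : ∀ x, ρ (W x) ∈ T) (a : A) : ρ a ∈ T := by
  have hcl : IsClosed ((T.comap ρ : StarSubalgebra ℂ A) : Set A) :=
    hT.preimage (map_continuous ρ)
  have hle : (StarAlgebra.adjoin ℂ (Set.range W)).topologicalClosure ≤ T.comap ρ := by
    refine StarSubalgebra.topologicalClosure_minimal (StarAlgebra.adjoin_le ?_) hcl
    rintro _ ⟨x, rfl⟩
    exact h x
  rw [hW.generates] at hle
  exact hle StarSubalgebra.mem_top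

/-- Factor a ⊗ b as (a ⊗ 1)(1 ⊗ b). Each factor is the image of a ⋆-homomorphism of `A`, so it
suffices to treat Weyl unitaries; W(0) = 1 makes W(x) ⊗ 1 and 1 ⊗ W(x) generators. -/
theorem spatialTensor_le_closure_adjoin_weyl (hW : IsWeylAlgebra W) :
    spatialTensor π₁ π₂ ≤ (StarAlgebra.adjoin ℂ (Set.range fun z : (ℝ × ℝ) × (ℝ × ℝ) =>
      opTensor (π₁ (W z.1)) (π₂ (W z.2)))).topologicalClosure := by
  set T := (StarAlgebra.adjoin ℂ (Set.range fun z : (ℝ × ℝ) × (ℝ × ℝ) =>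
      opTensor (π₁ (W z.1)) (π₂ (W z.2)))).topologicalClosure with hT
  have hcl : IsClosed (T : Set (HilbertTensor H K →L[ℂ] HilbertTensor H K)) :=
    StarSubalgebra.isClosed_topologicalClosure _
  have hmem : ∀ x y, opTensor (π₁ (W x)) (π₂ (W y)) ∈ T := fun x y =>
    StarSubalgebra.le_topologicalClosure _ (StarAlgebra.subset_adjoin ℂ _ ⟨(x, y), rfl⟩)
  refine StarSubalgebra.topologicalClosure_minimal (StarAlgebra.adjoin_le ?_) hcl
  rintro _ ⟨⟨a, b⟩, rfl⟩
  change opTensor (π₁ a) (π₂ b) ∈ T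
  rw [opTensor_eq_ampliation_mul]
  refine mul_mem (hW.map_mem ((leftAmpliation H K).comp π₁) T hcl (fun x => ?_) a)
    (hW.map_mem ((rightAmpliation H K).comp π₂) T hcl (fun x => ?_) b)
  · have := hmem x 0
    rwa [hW.zero, map_one] at this
  · have := hmem 0 x
    rwa [hW.zero, map_one] at this

theorem dense_span_spatialTmul_weyl (hW : IsWeylAlgebra W) :
    Dense (Submodule.span ℂ (Set.range fun z : (ℝ × ℝ) × (ℝ × ℝ) =>
      spatialTmul π₁ π₂ (W z.1) (W z.2)) : Set (spatialTensor π₁ π₂)) := by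
  set V : (ℝ × ℝ) × (ℝ × ℝ) → spatialTensor π₁ π₂ := fun z => spatialTmul π₁ π₂ (W z.1) (W z.2)
  have hone : V 0 = 1 := Subtype.ext <| by
    change opTensor (π₁ (W 0)) (π₂ (W 0)) = 1
    rw [hW.zero, map_one, map_one, opTensor_one]
  have hmul : ∀ z w, V z * V w =
      Complex.exp (Complex.I * (twoModeForm z w : ℂ)) • V (z + w) := spatialTmul_weyl π₁ π₂ hW
  have hstar : ∀ z, star (V z) = V (-z) := fun z =>
    left_inv_eq_right_inv
      (Unitary.mem_iff.mp (spatialTmul_mem_unitary π₁ π₂ (hW.unitary z.1) (hW.unitary z.2))).1 (by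
        have h0 : twoModeForm z (-z) = 0 := by
          simp only [twoModeForm, weylForm, Prod.fst_neg, Prod.snd_neg]
          ring
        change V z * V (-z) = 1
        rw [hmul, add_neg_cancel, hone, h0]
        simp)
  rw [Subtype.dense_iff]
  intro x hx
  have hx' := spatialTensor_le_closure_adjoin_weyl π₁ π₂ hW hx
  refine closure_mono ?_ hx'
  refine (adjoin_range_le_span (fun z => (V z : HilbertTensor H K →L[ℂ] HilbertTensor H K))
    (congrArg Subtype.val hone) (fun z => congrArg Subtype.val (hstar z))
    fun z w => ⟨_, congrArg Subtype.val (hmul z w)⟩).trans ?_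
  intro y hy
  -- The span was computed among all operators; it is pulled back to the span inside the subalgebra.
  have hmap : Submodule.span ℂ (Set.range fun z =>
      (V z : HilbertTensor H K →L[ℂ] HilbertTensor H K)) ≤
      (Submodule.span ℂ (Set.range V)).map (spatialTensor π₁ π₂).subtype.toAlgHom.toLinearMap := by
    refine Submodule.span_le.mpr ?_
    rintro _ ⟨z, rfl⟩
    exact ⟨V z, Submodule.subset_span ⟨z, rfl⟩, rfl⟩
  obtain ⟨v, hv, rfl⟩ := hmap hy
  exact ⟨v, hv, rfl⟩

theorem nontrivial_of_injective_rep [Nontrivial A] (hπ : Function.Injective π₁) : Nontrivial H := by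
  by_contra h
  rw [not_nontrivial_iff_subsingleton] at h
  exact one_ne_zero (hπ (ContinuousLinearMap.ext fun x => Subsingleton.elim _ _) : (1 : A) = 0)

theorem nontrivial_spatialTensor [Nontrivial H] [Nontrivial K] :
    Nontrivial (spatialTensor π₁ π₂) := by
  obtain ⟨x, hx⟩ := exists_ne (0 : H)
  obtain ⟨y, hy⟩ := exists_ne (0 : K)
  refine ⟨⟨1, 0, fun h => ?_⟩⟩
  have h1 : (1 : HilbertTensor H K →L[ℂ] HilbertTensor H K) = 0 := congrArg Subtype.val h
  have h2 : hilbertTmul x y = 0 :=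
    congrArg (fun T : HilbertTensor H K →L[ℂ] HilbertTensor H K => T (hilbertTmul x y)) h1
  have h3 := inner_hilbertTmul x x y y
  rw [h2, inner_zero_left] at h3
  rcases mul_eq_zero.mp h3.symm with h4 | h4
  · exact hx (inner_self_eq_zero.mp h4)
  · exact hy (inner_self_eq_zero.mp h4)

/-- Faithfulness serves to make both Hilbert spaces, hence the tensor product algebra, nonzero. -/
theorem isTwoModeWeyl_spatialTmul (hW : IsWeylAlgebra W) (hπ₁ : Function.Injective π₁)
    (hπ₂ : Function.Injective π₂) :
    IsTwoModeWeyl fun z : (ℝ × ℝ) × (ℝ × ℝ) => spatialTmul π₁ π₂ (W z.1) (W z.2) where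
  nontrivial := by
    have := hW.nontrivial
    have := nontrivial_of_injective_rep π₁ hπ₁
    have := nontrivial_of_injective_rep π₂ hπ₂
    exact nontrivial_spatialTensor π₁ π₂
  unitary z := spatialTmul_mem_unitary π₁ π₂ (hW.unitary _) (hW.unitary _)
  weyl := spatialTmul_weyl π₁ π₂ hW
  dense_span := dense_span_spatialTmul_weyl π₁ π₂ hW

theorem isTwoModeEPR_iff {lam mu : ℝ} {ω : spatialTensor π₁ π₂ →ₗ[ℂ] ℂ} :
    IsTwoModeEPR (fun z : (ℝ × ℝ) × (ℝ × ℝ) => spatialTmul π₁ π₂ (W z.1) (W z.2)) lam mu ω ↔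
      IsEPRState W π₁ π₂ lam mu ω := by
  have hp : ∀ a : ℝ, eprVector (a, 0) = ((a, 0), (-a, 0)) := fun a => rfl
  have hm : ∀ b : ℝ, eprVector (0, b) = ((0, b), (0, b)) := fun b => by simp [eprVector]
  constructor
  · rintro ⟨h1, h2, h3⟩
    simp only [hp, hm] at h2 h3
    exact ⟨h1, h2, h3⟩
  · rintro ⟨h1, h2, h3⟩
    refine ⟨h1, ?_, ?_⟩
    · simpa only [hp] using h2
    · simpa only [hm] using h3

end WeylTensor

end

theorem theorem1 {A : Type*} [CStarAlgebra A] (W : ℝ × ℝ → A) (hW : IsWeylAlgebra W)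
    {H₁ : Type*} [NormedAddCommGroup H₁] [InnerProductSpace ℂ H₁] [CompleteSpace H₁]
    {H₂ : Type*} [NormedAddCommGroup H₂] [InnerProductSpace ℂ H₂] [CompleteSpace H₂]
    (π₁ : A →⋆ₐ[ℂ] (H₁ →L[ℂ] H₁)) (hπ₁ : Function.Injective π₁)
    (π₂ : A →⋆ₐ[ℂ] (H₂ →L[ℂ] H₂)) (hπ₂ : Function.Injective π₂)
    (lam mu : ℝ) :
    (∃! ω : spatialTensor π₁ π₂ →ₗ[ℂ] ℂ, IsEPRState W π₁ π₂ lam mu ω) ∧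
      ∀ ω : spatialTensor π₁ π₂ →ₗ[ℂ] ℂ, IsEPRState W π₁ π₂ lam mu ω → IsPureState ω := by
  let _ := spatialTensorCStarAlgebra π₁ π₂
  have hV := isTwoModeWeyl_spatialTmul π₁ π₂ hW hπ₁ hπ₂
  obtain ⟨ω, hω⟩ := hV.exists_isTwoModeEPR lam mu
  exact ⟨⟨ω, (isTwoModeEPR_iff π₁ π₂).mp hω, fun ω' hω' =>
    hV.eq_of_isTwoModeEPR ((isTwoModeEPR_iff π₁ π₂).mpr hω') hω⟩,
    fun ω' hω' => hV.isPureState ((isTwoModeEPR_iff π₁ π₂).mpr hω')⟩
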